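/- Let $M^n$ be a smooth Riemannian manifold of dimension $n\ge 3$, let $p\in M$, and let $e_1,\dots,e_n$ be an orthonormal basis of $V=T_pM$. Let $R_{ijkl}=\langle R(e_i,e_j)e_l,e_k\rangle$ be the components of the Riemann curvature tensor at $p$ of the Levi-Civita connection, where $R(X,Y)Z=\nabla_X\nabla_YZ-\nabla_Y\nabla_XZ-\nabla_{[X,Y]}Z$, and put $R_{jl}=\sum_k R_{kjkl}$, $R=\sum_j R_{jj}$. For a fourth-order covariant tensor with components $T_{ijkl}$ on $V$ put $$T^{(1,2)}_{ij}=\sum_k T_{kkij},\quad T^{(1,3)}_{ij}=\sum_k T_{kikj},\quad T^{(1,4)}_{ij}=\sum_k T_{kijk},$$ $$T^{(2,3)}_{ij}=\sum_k T_{ikkj},\quad T^{(2,4)}_{ij}=\sum_k T_{ikjk},\quad T^{(3,4)}_{ij}=\sum_k T_{ijkk}.$$ For a bilinear form $A_{ij}$ on $V$ and real numbers $a_1,\dots,a_6,a^1,\dots,a^6$ (upper indices are labels, not powers) write $$\begin{aligned}L_{a}(A)_{ijkl}={}&a_1A_{ij}\delta_{kl}+a_2A_{ik}\delta_{jl}+a_3A_{il}\delta_{jk}+a_4A_{jk}\delta_{il}+a_5A_{jl}\delta_{ik}+a_6A_{kl}\delta_{ij}\\&+a^1A_{ji}\delta_{kl}+a^2A_{ki}\delta_{jl}+a^3A_{li}\delta_{jk}+a^4A_{kj}\delta_{il}+a^5A_{lj}\delta_{ik}+a^6A_{lk}\delta_{ij}.\end{aligned}$$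 The fourth-order problem for $T$ is to minimize $h=\|F\|^2=\sum_{i,j,k,l}F_{ijkl}^2$ over all real values of the $75$ variables $x_m,x^m,y_m,y^m,z_m,z^m,u_m,u^m,v_m,v^m,w_m,w^m$ $(1\le m\le 6)$ and $r,s,t$, where $$\begin{aligned}F={}&T+L_x(T^{(1,2)})+L_y(T^{(1,3)})+L_z(T^{(1,4)})+L_u(T^{(2,3)})+L_v(T^{(2,4)})+L_w(T^{(3,4)})\\&+r\,\delta_{ij}\delta_{kl}+s\,\delta_{ik}\delta_{jl}+t\,\delta_{il}\delta_{jk}.\end{aligned}$$ A tensor $F$ of this form at which the minimum of $h$ is attained is called a minimal norm tensor of $T$. Then, for $T_{ijkl}=R_{ijkl}$, there is exactly one minimal norm tensor, and it is the Weyl conformal curvature tensor $$W_{ijkl}=R_{ijkl}-\frac{1}{n-2}\bigl[R_{jl}\delta_{ik}-R_{jk}\delta_{il}-R_{il}\delta_{jk}+R_{ik}\delta_{jl}\bigr]+\frac{R}{(n-1)(n-2)}\bigl(\delta_{jl}\delta_{ik}-\delta_{jk}\delta_{il}\bigr).$$ -/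

import Mathlib

open scoped Manifold ContDiff
open Bundle

noncomputable section

namespace MinimalNormTensor

/-! ### Fourth-order covariant tensors in components, and the minimal norm problem -/

/-- The components `T i j k l = T(e_i, e_j, e_k, e_l)` of a fourth-order covariant tensor
with respect to an orthonormal basis of an `n`-dimensional inner product space. -/
abbrev Tensor4 (n : ℕ) := Fin n → Fin n → Fin n → Fin n → ℝ

/-- The Kronecker delta. -/
def delta {n : ℕ} (i j : Fin n) : ℝ := if i = j then 1 else 0

/-- The squared norm `‖F‖² = ∑ F_{ijkl}²`. -/
def normSq {n : ℕ} (F : Tensor4 n) : ℝ := ∑ i, ∑ j, ∑ k, ∑ l, F i j k l ^ 2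

def trace12 {n : ℕ} (T : Tensor4 n) (i j : Fin n) : ℝ := ∑ k, T k k i j
def trace13 {n : ℕ} (T : Tensor4 n) (i j : Fin n) : ℝ := ∑ k, T k i k j
def trace14 {n : ℕ} (T : Tensor4 n) (i j : Fin n) : ℝ := ∑ k, T k i j k
def trace23 {n : ℕ} (T : Tensor4 n) (i j : Fin n) : ℝ := ∑ k, T i k k j
def trace24 {n : ℕ} (T : Tensor4 n) (i j : Fin n) : ℝ := ∑ k, T i k j k
def trace34 {n : ℕ} (T : Tensor4 n) (i j : Fin n) : ℝ := ∑ k, T i j k k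

/-- The twelve terms of the ansatz that belong to one trace `A`, with free coefficients:
`a₁ A_{ij} δ_{kl} + a₂ A_{ik} δ_{jl} + a₃ A_{il} δ_{jk} + a₄ A_{jk} δ_{il} + a₅ A_{jl} δ_{ik}
+ a₆ A_{kl} δ_{ij}`, and the same with the transpose of `A` and coefficients `b₁, …, b₆`. -/
def traceTerms {n : ℕ} (a b : Fin 6 → ℝ) (A : Fin n → Fin n → ℝ) : Tensor4 n :=
  fun i j k l =>
    a 0 * A i j * delta k l + a 1 * A i k * delta j l + a 2 * A i l * delta j k
      + a 3 * A j k * delta i l + a 4 * A j l * delta i k + a 5 * A k l * delta i j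
      + b 0 * A j i * delta k l + b 1 * A k i * delta j l + b 2 * A l i * delta j k
      + b 3 * A k j * delta i l + b 4 * A l j * delta i k + b 5 * A l k * delta i j

/-- The 75 real variables of the fourth-order problem; `x` holds the coefficients written with
lower indices `x₁, …, x₆` and `x'` those with upper indices `x¹, …, x⁶`, and so on. -/
structure Coeffs where
  (x x' y y' z z' u u' v v' w w' : Fin 6 → ℝ)
  (r s t : ℝ)

/-- The tensor `F_{ijkl}` of the fourth-order problem, for the tensor `T` and the coefficients
`c`. -/
def ansatz {n : ℕ} (T : Tensor4 n) (c : Coeffs) : Tensor4 n :=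
  fun i j k l =>
    T i j k l
      + traceTerms c.x c.x' (trace12 T) i j k l
      + traceTerms c.y c.y' (trace13 T) i j k l
      + traceTerms c.z c.z' (trace14 T) i j k l
      + traceTerms c.u c.u' (trace23 T) i j k l
      + traceTerms c.v c.v' (trace24 T) i j k l
      + traceTerms c.w c.w' (trace34 T) i j k l
      + c.r * delta i j * delta k l + c.s * delta i k * delta j l + c.t * delta i l * delta j k

/-- `F` is a minimal norm tensor of `T`: it is the value of the ansatz at some choice of the
coefficients at which `h = ‖F‖²` attains its minimum over all choices of the coefficients. -/
def IsMinimalNormTensor {n : ℕ} (T F : Tensor4 n) : Prop :=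
  ∃ c : Coeffs, ansatz T c = F ∧ ∀ c' : Coeffs, normSq (ansatz T c) ≤ normSq (ansatz T c')

/-! ### Ricci, scalar and Weyl curvature in an orthonormal basis -/

/-- `R_{jl} = ∑_k R_{kjkl}`. -/
def ricci {n : ℕ} (R : Tensor4 n) (j l : Fin n) : ℝ := ∑ k, R k j k l

/-- The scalar curvature `∑_j R_{jj}`. -/
def scalar {n : ℕ} (R : Tensor4 n) : ℝ := ∑ j, ricci R j j

/-- The Weyl conformal curvature tensor of a curvature tensor `R_{ijkl}`. -/
def weyl {n : ℕ} (R : Tensor4 n) : Tensor4 n :=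
  fun i j k l =>
    R i j k l
      - 1 / ((n : ℝ) - 2) *
        (ricci R j l * delta i k - ricci R j k * delta i l - ricci R i l * delta j k
          + ricci R i k * delta j l)
      + scalar R / (((n : ℝ) - 1) * ((n : ℝ) - 2)) *
        (delta j l * delta i k - delta j k * delta i l)

/-! ### The Riemann curvature tensor of the Levi-Civita connection

Everything is computed in the coordinates given by the preferred chart around the point `p`. -/

section Curvature

variable {n : ℕ} {M : Type*} [TopologicalSpace M] [ChartedSpace (EuclideanSpace ℝ (Fin n)) M]

/-- The coordinate vector field `∂_i` of the chart around `p`, at the point of `M` with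
coordinates `y`. -/
def coordVec (p : M) (y : EuclideanSpace ℝ (Fin n)) (i : Fin n) :
    TangentSpace (𝓡 n) ((extChartAt (𝓡 n) p).symm y) :=
  mfderiv 𝓘(ℝ, EuclideanSpace ℝ (Fin n)) (𝓡 n) (extChartAt (𝓡 n) p).symm y
    (EuclideanSpace.single i (1 : ℝ))

/-- The components of a tangent vector at `p` in the chart around `p`: `v = ∑ v^i ∂_i`. -/
def coordComp (p : M) (v : TangentSpace (𝓡 n) p) : EuclideanSpace ℝ (Fin n) :=
  mfderiv (𝓡 n) 𝓘(ℝ, EuclideanSpace ℝ (Fin n)) (extChartAt (𝓡 n) p) p v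

/-- The partial derivative `∂_i f` at the point `y` of the coordinate space. -/
def partialDeriv (i : Fin n) (f : EuclideanSpace ℝ (Fin n) → ℝ)
    (y : EuclideanSpace ℝ (Fin n)) : ℝ :=
  fderiv ℝ f y (EuclideanSpace.single i (1 : ℝ))

variable [RiemannianBundle (fun x : M ↦ TangentSpace (𝓡 n) x)]

/-- The metric coefficients `g_{ij} = ⟨∂_i, ∂_j⟩`, as functions of the coordinates. -/
def metricCoeff (p : M) (y : EuclideanSpace ℝ (Fin n)) : Matrix (Fin n) (Fin n) ℝ :=
  Matrix.of fun i j => inner ℝ (coordVec p y i) (coordVec p y j)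

/-- The Christoffel symbols of the Levi-Civita connection,
`Γ^m_{ij} = ½ ∑_a g^{ma} (∂_i g_{ja} + ∂_j g_{ia} - ∂_a g_{ij})`, so that
`∇_{∂_i} ∂_j = ∑_m Γ^m_{ij} ∂_m`. -/
def christoffel (p : M) (m i j : Fin n) (y : EuclideanSpace ℝ (Fin n)) : ℝ :=
  1 / 2 * ∑ a, (metricCoeff p y)⁻¹ m a *
    (partialDeriv i (fun y' => metricCoeff p y' j a) y
      + partialDeriv j (fun y' => metricCoeff p y' i a) y
      - partialDeriv a (fun y' => metricCoeff p y' i j) y)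

/-- The components at `p` of the curvature operator
`R(X, Y)Z = ∇_X ∇_Y Z - ∇_Y ∇_X Z - ∇_{[X, Y]} Z` in the coordinate frame:
`R(∂_i, ∂_j) ∂_k = ∑_m (curvatureCoeff p m i j k) ∂_m`. -/
def curvatureCoeff (p : M) (m i j k : Fin n) : ℝ :=
  let y₀ := extChartAt (𝓡 n) p p
  partialDeriv i (christoffel p m j k) y₀ - partialDeriv j (christoffel p m i k) y₀
    + ∑ a, (christoffel p m i a y₀ * christoffel p a j k y₀
      - christoffel p m j a y₀ * christoffel p a i k y₀)

/-- The Riemann curvature tensor at `p` as a fourth-order covariant tensor on `T_pM`,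
`Rm(X, Y, Z, W) = ⟨R(X, Y)W, Z⟩`. With this convention `Rm(X, Y, X, Y)` is the sectional
curvature of the plane spanned by orthonormal `X, Y`. -/
def riemann (p : M) (X Y Z W : TangentSpace (𝓡 n) p) : ℝ :=
  ∑ i, ∑ j, ∑ k, ∑ l,
    coordComp p X i * coordComp p Y j * coordComp p Z k * coordComp p W l *
      ∑ m, metricCoeff p (extChartAt (𝓡 n) p p) k m * curvatureCoeff p m i j l

/-- The components `R_{ijkl} = Rm(e_i, e_j, e_k, e_l)` of the curvature tensor at `p` in an
orthonormal basis of `T_pM`. -/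
def riemannComponents (p : M) (e : OrthonormalBasis (Fin n) ℝ (TangentSpace (𝓡 n) p)) :
    Tensor4 n :=
  fun i j k l => riemann p (e i) (e j) (e k) (e l)

end Curvature

end MinimalNormTensor

end

namespace MinimalNormTensor

/-! ### Pythagoras for trace-free tensors -/

section Algebra

variable {n : ℕ}

/-! Every correction term of the ansatz is a bilinear form times a Kronecker delta in the two
remaining slots. Its inner product with a tensor `W` is therefore a contraction of `W` paired with
that form, and it vanishes when all six contractions of `W` do. So the values of the ansatz lie in
an affine family whose directions are orthogonal to every trace-free `W`. If such a `W` is itself a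
value of the ansatz, Pythagoras gives `‖F‖² = ‖W‖² + ‖F - W‖²` for every value `F`, and `W` is the
only minimizer (`IsTraceFree.isMinimalNormTensor_iff`).

The Weyl tensor is a value of the ansatz by inspection (`ansatz_weylCoeffs`). Its trace-freeness
(`isTraceFree_weyl`) needs only that `R` is antisymmetric in its first and in its last pair of
indices; neither the Bianchi identity nor symmetry of Ricci enters. The first antisymmetry is
visible in the coordinate formula. The second is metric compatibility together with equality of
mixed partials of `g` (`sum_mul_curvatureUpper_swap`). -/

/-- The fourth-order tensors orthogonal to `W`. -/
def orthogonal (W : Tensor4 n) : Submodule ℝ (Tensor4 n) where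
  carrier := {G | ∑ i, ∑ j, ∑ k, ∑ l, W i j k l * G i j k l = 0}
  zero_mem' := by simp
  add_mem' {G H} hG hH := by
    simp only [Set.mem_ofPred_eq] at hG hH
    simp [mul_add, Finset.sum_add_distrib, hG, hH]
  smul_mem' c G hG := by
    simp only [Set.mem_ofPred_eq] at hG
    simp [mul_left_comm _ c, ← Finset.mul_sum, hG]

theorem mem_orthogonal {W G : Tensor4 n} :
    G ∈ orthogonal W ↔ ∑ i, ∑ j, ∑ k, ∑ l, W i j k l * G i j k l = 0 := Iff.rfl

theorem normSq_add_of_mem_orthogonal {W G : Tensor4 n} (h : G ∈ orthogonal W) :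
    normSq (W + G) = normSq W + normSq G := by
  have h2 : ∑ i, ∑ j, ∑ k, ∑ l, 2 * (W i j k l * G i j k l) = 0 := by
    simp only [← Finset.mul_sum, mem_orthogonal.1 h, mul_zero]
  have : normSq (W + G) = normSq W + ∑ i, ∑ j, ∑ k, ∑ l, 2 * (W i j k l * G i j k l)
      + normSq G := by
    simp only [normSq, ← Finset.sum_add_distrib, Pi.add_apply]
    refine Finset.sum_congr rfl fun i _ => Finset.sum_congr rfl fun j _ =>
      Finset.sum_congr rfl fun k _ => Finset.sum_congr rfl fun l _ => ?_
    ring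
  rw [this, h2, add_zero]

theorem normSq_nonneg (G : Tensor4 n) : 0 ≤ normSq G := by
  unfold normSq; positivity

theorem eq_zero_of_normSq_eq_zero {G : Tensor4 n} (h : normSq G = 0) : G = 0 := by
  funext i j k l
  rw [normSq, Fintype.sum_eq_zero_iff_of_nonneg (fun _ => by positivity)] at h
  have h := congrFun h i
  rw [Pi.zero_apply, Fintype.sum_eq_zero_iff_of_nonneg (fun _ => by positivity)] at h
  have h := congrFun h j
  rw [Pi.zero_apply, Fintype.sum_eq_zero_iff_of_nonneg (fun _ => by positivity)] at h
  have h := congrFun h k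
  rw [Pi.zero_apply, Fintype.sum_eq_zero_iff_of_nonneg (fun _ => by positivity)] at h
  simpa using congrFun h l

/-- All six contractions of `W` vanish. -/
structure IsTraceFree (W : Tensor4 n) : Prop where
  trace12_eq : ∀ i j, trace12 W i j = 0
  trace13_eq : ∀ i j, trace13 W i j = 0
  trace14_eq : ∀ i j, trace14 W i j = 0
  trace23_eq : ∀ i j, trace23 W i j = 0
  trace24_eq : ∀ i j, trace24 W i j = 0
  trace34_eq : ∀ i j, trace34 W i j = 0

/-! ### Orthogonality of the ansatz directions to trace-free tensors. -/

namespace IsTraceFree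

variable {W : Tensor4 n} (hW : IsTraceFree W) (A : Fin n → Fin n → ℝ)
include hW

theorem delta34_mem : (fun i j k l => A i j * delta k l : Tensor4 n) ∈ orthogonal W := by
  have (i j : Fin n) : ∑ k, W i j k k * A i j = 0 := by
    rw [← Finset.sum_mul, show ∑ k, W i j k k = 0 from hW.trace34_eq i j, zero_mul]
  simp [mem_orthogonal, delta, this]

theorem delta24_mem : (fun i j k l => A i k * delta j l : Tensor4 n) ∈ orthogonal W := by
  have (i j : Fin n) : ∑ k, W i k j k * A i j = 0 := by
    rw [← Finset.sum_mul, show ∑ k, W i k j k = 0 from hW.trace24_eq i j, zero_mul]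
  simp only [mem_orthogonal, delta, mul_ite, mul_one, mul_zero, Finset.sum_ite_eq,
    Finset.mem_univ, if_true]
  refine Finset.sum_eq_zero fun i _ => ?_
  rw [Finset.sum_comm]
  simp [this]

theorem delta23_mem : (fun i j k l => A i l * delta j k : Tensor4 n) ∈ orthogonal W := by
  have (i j : Fin n) : ∑ k, W i k k j * A i j = 0 := by
    rw [← Finset.sum_mul, show ∑ k, W i k k j = 0 from hW.trace23_eq i j, zero_mul]
  rw [mem_orthogonal]
  refine Finset.sum_eq_zero fun i _ => ?_
  rw [Finset.sum_congr rfl fun j _ => Finset.sum_comm, Finset.sum_comm]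
  simp [delta, this]

theorem delta14_mem : (fun i j k l => A j k * delta i l : Tensor4 n) ∈ orthogonal W := by
  have (i j : Fin n) : ∑ k, W k i j k * A i j = 0 := by
    rw [← Finset.sum_mul, show ∑ k, W k i j k = 0 from hW.trace14_eq i j, zero_mul]
  rw [mem_orthogonal, Finset.sum_comm]
  refine Finset.sum_eq_zero fun j _ => ?_
  rw [Finset.sum_comm]
  simp [delta, this]

theorem delta13_mem : (fun i j k l => A j l * delta i k : Tensor4 n) ∈ orthogonal W := by
  have (i j : Fin n) : ∑ k, W k i k j * A i j = 0 := by
    rw [← Finset.sum_mul, show ∑ k, W k i k j = 0 from hW.trace13_eq i j, zero_mul]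
  rw [mem_orthogonal, Finset.sum_comm]
  refine Finset.sum_eq_zero fun j _ => ?_
  rw [Finset.sum_congr rfl fun i _ => Finset.sum_comm, Finset.sum_comm]
  simp [delta, this]

theorem delta12_mem : (fun i j k l => A k l * delta i j : Tensor4 n) ∈ orthogonal W := by
  have (i j : Fin n) : ∑ k, W k k i j * A i j = 0 := by
    rw [← Finset.sum_mul, show ∑ k, W k k i j = 0 from hW.trace12_eq i j, zero_mul]
  rw [mem_orthogonal]
  have h (i : Fin n) : ∑ j, ∑ k, ∑ l, W i j k l * (A k l * delta i j)
      = ∑ k, ∑ l, W i i k l * A k l := by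
    rw [Finset.sum_eq_single i (fun j _ hj => by simp [delta, hj.symm]) (by simp)]
    simp [delta]
  simp only [h]
  rw [Finset.sum_comm]
  refine Finset.sum_eq_zero fun k _ => ?_
  rw [Finset.sum_comm]
  simp [this]

theorem traceTerms_mem (a b : Fin 6 → ℝ) : traceTerms a b A ∈ orthogonal W := by
  -- For each delta, the terms in `A` and in its transpose merge into one bilinear form, so six
  -- memberships cover all twelve terms.
  have h1 := hW.delta34_mem fun i j => a 0 * A i j + b 0 * A j i
  have h2 := hW.delta24_mem fun i j => a 1 * A i j + b 1 * A j i
  have h3 := hW.delta23_mem fun i j => a 2 * A i j + b 2 * A j i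
  have h4 := hW.delta14_mem fun i j => a 3 * A i j + b 3 * A j i
  have h5 := hW.delta13_mem fun i j => a 4 * A i j + b 4 * A j i
  have h6 := hW.delta12_mem fun i j => a 5 * A i j + b 5 * A j i
  convert add_mem (add_mem (add_mem (add_mem (add_mem h1 h2) h3) h4) h5) h6 using 1
  funext i j k l
  simp only [traceTerms, Pi.add_apply]
  ring

theorem ansatz_sub_mem (T : Tensor4 n) (c : Coeffs) : ansatz T c - T ∈ orthogonal W := by
  have h1 := hW.traceTerms_mem (trace12 T) c.x c.x'
  have h2 := hW.traceTerms_mem (trace13 T) c.y c.y'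
  have h3 := hW.traceTerms_mem (trace14 T) c.z c.z'
  have h4 := hW.traceTerms_mem (trace23 T) c.u c.u'
  have h5 := hW.traceTerms_mem (trace24 T) c.v c.v'
  have h6 := hW.traceTerms_mem (trace34 T) c.w c.w'
  have h7 := hW.delta34_mem fun i j => c.r * delta i j
  have h8 := hW.delta24_mem fun i j => c.s * delta i j
  have h9 := hW.delta23_mem fun i j => c.t * delta i j
  convert add_mem (add_mem (add_mem (add_mem (add_mem (add_mem (add_mem (add_mem
    h1 h2) h3) h4) h5) h6) h7) h8) h9 using 1
  funext i j k l
  simp only [ansatz, Pi.add_apply, Pi.sub_apply]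
  ring

/-- A trace-free tensor of the form of the ansatz is the unique minimal norm tensor. -/
theorem isMinimalNormTensor_iff {T : Tensor4 n} {c₀ : Coeffs} (h₀ : ansatz T c₀ = W)
    (F : Tensor4 n) : IsMinimalNormTensor T F ↔ F = W := by
  have key (c : Coeffs) : normSq (ansatz T c) = normSq W + normSq (ansatz T c - W) := by
    rw [← normSq_add_of_mem_orthogonal, add_sub_cancel]
    -- `T` need not be orthogonal to `W`, but it cancels in the difference of two values of the
    -- ansatz.
    have := sub_mem (hW.ansatz_sub_mem T c) (hW.ansatz_sub_mem T c₀)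
    rwa [sub_sub_sub_cancel_right, h₀] at this
  constructor
  · rintro ⟨c, rfl, hc⟩
    have h := hc c₀
    rw [h₀, key c] at h
    exact sub_eq_zero.1 (eq_zero_of_normSq_eq_zero
      (le_antisymm (by linarith) (normSq_nonneg _)))
  · rintro rfl
    refine ⟨c₀, h₀, fun c => ?_⟩
    rw [h₀, key c]
    exact le_add_of_nonneg_right (normSq_nonneg _)

end IsTraceFree

/-- The coefficients for which the ansatz is the Weyl tensor. -/
noncomputable def weylCoeffs (T : Tensor4 n) : Coeffs where
  x := 0
  x' := 0
  y := ![0, -(1 / ((n : ℝ) - 2)), 1 / ((n : ℝ) - 2), 1 / ((n : ℝ) - 2),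
    -(1 / ((n : ℝ) - 2)), 0]
  y' := 0
  z := 0
  z' := 0
  u := 0
  u' := 0
  v := 0
  v' := 0
  w := 0
  w' := 0
  r := 0
  s := scalar T / (((n : ℝ) - 1) * ((n : ℝ) - 2))
  t := -(scalar T / (((n : ℝ) - 1) * ((n : ℝ) - 2)))

theorem ansatz_weylCoeffs (T : Tensor4 n) : ansatz T (weylCoeffs T) = weyl T := by
  have h : trace13 T = ricci T := rfl
  have h5 : (![0, -(1 / ((n : ℝ) - 2)), 1 / ((n : ℝ) - 2), 1 / ((n : ℝ) - 2),
    -(1 / ((n : ℝ) - 2)), 0] : Fin 6 → ℝ) 5 = 0 := rfl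
  have h4 : (![0, -(1 / ((n : ℝ) - 2)), 1 / ((n : ℝ) - 2), 1 / ((n : ℝ) - 2),
    -(1 / ((n : ℝ) - 2)), 0] : Fin 6 → ℝ) 4 = -(1 / ((n : ℝ) - 2)) := rfl
  funext i j k l
  simp only [ansatz, traceTerms, weylCoeffs, weyl, h, h4, h5, Pi.zero_apply, Matrix.cons_val]
  ring

/-- The tensor inherits both antisymmetries, so the (1,2) and (3,4) traces vanish and the other
three equal the (1,3) trace up to sign. Only that one has to be computed. -/
theorem isTraceFree_weyl (hn : 3 ≤ n) {T : Tensor4 n}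
    (h12 : ∀ i j k l, T j i k l = -T i j k l) (h34 : ∀ i j k l, T i j l k = -T i j k l) :
    IsTraceFree (weyl T) := by
  have w12 (i j k l) : weyl T j i k l = -weyl T i j k l := by
    simp only [weyl, h12 i j k l]; ring
  have w34 (i j k l) : weyl T i j l k = -weyl T i j k l := by
    simp only [weyl, h34 i j k l]; ring
  have h13 (j l) : ∑ k, weyl T k j k l = 0 := by
    have e1 : ∑ k, T k j k l = ricci T j l := rfl
    have e2 : ∑ k, ricci T k k = scalar T := rfl
    have hd : (delta l j : ℝ) = delta j l := by simp [delta, eq_comm]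
    have a1 : ∑ k : Fin n, ricci T j l * delta k k = n * ricci T j l := by simp [delta]
    have a2 : ∑ k, ricci T j k * delta k l = ricci T j l := by simp [delta]
    have a3 : ∑ k, ricci T k l * delta j k = ricci T j l := by simp [delta]
    have a4 : ∑ k, ricci T k k * delta j l = scalar T * delta j l := by
      rw [← Finset.sum_mul, e2]
    have a5 : ∑ k : Fin n, delta j l * delta k k = n * delta j l := by simp [delta]
    have a6 : ∑ k : Fin n, delta j k * delta k l = delta j l := by simp [delta]
    simp only [weyl, Finset.sum_add_distrib, Finset.sum_sub_distrib, ← Finset.mul_sum,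
      e1, a1, a2, a3, a4, a5, a6]
    have h3 : (3 : ℝ) ≤ n := by exact_mod_cast hn
    have n1 : (n : ℝ) - 1 ≠ 0 := by linarith
    have n2 : (n : ℝ) - 2 ≠ 0 := by linarith
    field_simp
    ring
  refine ⟨fun i j => ?_, h13, fun i j => ?_, fun i j => ?_, fun i j => ?_, fun i j => ?_⟩
  · exact Finset.sum_eq_zero fun k _ => by linarith [w12 k k i j]
  · simp only [trace14, w34 _ _ _ j, Finset.sum_neg_distrib, h13, neg_zero]
  · simp only [trace23, fun k => w12 k i k j, Finset.sum_neg_distrib, h13, neg_zero]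
  · simp only [trace24, fun k => w12 k i j k, fun k => w34 k i k j, neg_neg, h13]
  · exact Finset.sum_eq_zero fun k _ => by linarith [w34 i j k k]

end Algebra

end MinimalNormTensor

namespace MinimalNormTensor

/-! ### Curvature of a metric in coordinates -/

section Coordinates

open Filter Topology

variable {n : ℕ}

/-! ### Calculus of coordinate partial derivatives. -/

theorem partialDeriv_add (i : Fin n) {f g : EuclideanSpace ℝ (Fin n) → ℝ}
    {y : EuclideanSpace ℝ (Fin n)} (hf : DifferentiableAt ℝ f y)
    (hg : DifferentiableAt ℝ g y) :
    partialDeriv i (fun z => f z + g z) y = partialDeriv i f y + partialDeriv i g y := by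
  simp [partialDeriv, fderiv_fun_add hf hg]

theorem partialDeriv_sum_mul (i : Fin n) {f g : Fin n → EuclideanSpace ℝ (Fin n) → ℝ}
    {y : EuclideanSpace ℝ (Fin n)}
    (hf : ∀ a, DifferentiableAt ℝ (f a) y) (hg : ∀ a, DifferentiableAt ℝ (g a) y) :
    partialDeriv i (fun z => ∑ a, f a z * g a z) y
      = ∑ a, (partialDeriv i (f a) y * g a y + f a y * partialDeriv i (g a) y) := by
  have h : fderiv ℝ (fun z => ∑ a, f a z * g a z) y
      = ∑ a, (f a y • fderiv ℝ (g a) y + g a y • fderiv ℝ (f a) y) := by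
    rw [fderiv_fun_sum (u := Finset.univ) (A := fun a z => f a z * g a z) fun a _ => (hf a).mul (hg a)]
    exact Finset.sum_congr rfl fun a _ => fderiv_fun_mul (hf a) (hg a)
  simp only [partialDeriv, h, sum_apply, add_apply,
    smul_apply, smul_eq_mul]
  exact Finset.sum_congr rfl fun a _ => by ring

theorem partialDeriv_congr (i : Fin n) {f g : EuclideanSpace ℝ (Fin n) → ℝ}
    {y : EuclideanSpace ℝ (Fin n)} (h : f =ᶠ[𝓝 y] g) :
    partialDeriv i f y = partialDeriv i g y := by
  rw [partialDeriv, h.fderiv_eq, partialDeriv]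

theorem contDiffAt_partialDeriv (i : Fin n) {f : EuclideanSpace ℝ (Fin n) → ℝ}
    {y : EuclideanSpace ℝ (Fin n)} (hf : ContDiffAt ℝ 2 f y) :
    ContDiffAt ℝ 1 (partialDeriv i f) y :=
  (hf.fderiv_right (m := 1) (by norm_num)).clm_apply contDiffAt_const

theorem partialDeriv_comm (i j : Fin n) {f : EuclideanSpace ℝ (Fin n) → ℝ}
    {y : EuclideanSpace ℝ (Fin n)} (hf : ContDiffAt ℝ 2 f y) :
    partialDeriv i (partialDeriv j f) y = partialDeriv j (partialDeriv i f) y := by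
  have hd : DifferentiableAt ℝ (fderiv ℝ f) y :=
    (hf.fderiv_right (m := 1) (by norm_num)).differentiableAt (by norm_num)
  have h (k l : Fin n) : partialDeriv k (partialDeriv l f) y =
      fderiv ℝ (fderiv ℝ f) y (EuclideanSpace.single k 1) (EuclideanSpace.single l 1) := by
    have : fderiv ℝ (fun z => fderiv ℝ f z (EuclideanSpace.single l 1)) y
        = (fderiv ℝ (fderiv ℝ f) y).flip (EuclideanSpace.single l 1) := by
      rw [fderiv_clm_apply hd (differentiableAt_const _)]
      simp
    change fderiv ℝ (fun z => fderiv ℝ f z (EuclideanSpace.single l 1)) y _ = _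
    rw [this]
    rfl
  rw [h, h]
  exact hf.isSymmSndFDerivAt (by simp) _ _

/-- The Christoffel symbols of the first kind of the metric `g`. -/
noncomputable def christoffelLower (g : EuclideanSpace ℝ (Fin n) → Matrix (Fin n) (Fin n) ℝ)
    (a i j : Fin n) (y : EuclideanSpace ℝ (Fin n)) : ℝ :=
  1 / 2 * (partialDeriv i (fun z => g z j a) y + partialDeriv j (fun z => g z i a) y
    - partialDeriv a (fun z => g z i j) y)

/-- The Christoffel symbols of the second kind of the metric `g`. -/
noncomputable def christoffelUpper (g : EuclideanSpace ℝ (Fin n) → Matrix (Fin n) (Fin n) ℝ)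
    (m i j : Fin n) (y : EuclideanSpace ℝ (Fin n)) : ℝ :=
  1 / 2 * ∑ a, (g y)⁻¹ m a * (partialDeriv i (fun z => g z j a) y
    + partialDeriv j (fun z => g z i a) y - partialDeriv a (fun z => g z i j) y)

variable {g : EuclideanSpace ℝ (Fin n) → Matrix (Fin n) (Fin n) ℝ}

theorem christoffelUpper_eq (m i j : Fin n) (y : EuclideanSpace ℝ (Fin n)) :
    christoffelUpper g m i j y = ∑ a, (g y)⁻¹ m a * christoffelLower g a i j y := by
  rw [christoffelUpper, Finset.mul_sum]
  exact Finset.sum_congr rfl fun a _ => by rw [christoffelLower]; ring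

theorem sum_mul_christoffelUpper {y : EuclideanSpace ℝ (Fin n)} (hdet : IsUnit (g y).det)
    (k i j : Fin n) :
    ∑ m, g y k m * christoffelUpper g m i j y = christoffelLower g k i j y := by
  have h : (g y).mulVec (fun m => christoffelUpper g m i j y)
      = fun a => christoffelLower g a i j y := by
    have : (fun m => christoffelUpper g m i j y)
        = (g y)⁻¹.mulVec (fun a => christoffelLower g a i j y) := by
      funext m
      rw [christoffelUpper_eq]
      rfl
    rw [this, Matrix.mulVec_mulVec, Matrix.mul_nonsing_inv _ hdet, Matrix.one_mulVec]
  exact congrFun h k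

/-- Metric compatibility of the Levi-Civita connection, in coordinates. -/
theorem christoffelLower_add (hsymm : ∀ y i j, g y i j = g y j i) (k l i : Fin n)
    (y : EuclideanSpace ℝ (Fin n)) :
    christoffelLower g k i l y + christoffelLower g l i k y
      = partialDeriv i (fun z => g z k l) y := by
  have h (a b : Fin n) : (fun z => g z a b) = fun z => g z b a := funext fun z => hsymm z a b
  simp only [christoffelLower, h l k, h i k, h i l]
  ring

theorem contDiffAt_christoffelLower {y : EuclideanSpace ℝ (Fin n)}
    (hg : ∀ i j, ContDiffAt ℝ 2 (fun z => g z i j) y)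
    (a i j : Fin n) : ContDiffAt ℝ 1 (christoffelLower g a i j) y :=
  contDiffAt_const.mul (((contDiffAt_partialDeriv i (hg j a)).add
    (contDiffAt_partialDeriv j (hg i a))).sub (contDiffAt_partialDeriv a (hg i j)))

theorem contDiffAt_det {y : EuclideanSpace ℝ (Fin n)}
    {A : EuclideanSpace ℝ (Fin n) → Matrix (Fin n) (Fin n) ℝ} {r : WithTop ℕ∞}
    (hA : ∀ i j, ContDiffAt ℝ r (fun z => A z i j) y) :
    ContDiffAt ℝ r (fun z => (A z).det) y := by
  simp only [Matrix.det_apply']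
  exact ContDiffAt.sum fun σ _ => contDiffAt_const.mul (contDiffAt_prod fun i _ => hA _ _)

/-- By Cramer's rule the entries of the inverse are quotients of polynomials in the entries of `g`.
-/
theorem contDiffAt_inv_apply {y : EuclideanSpace ℝ (Fin n)}
    (hg : ∀ i j, ContDiffAt ℝ 2 (fun z => g z i j) y)
    (hdet : (g y).det ≠ 0) (i j : Fin n) : ContDiffAt ℝ 2 (fun z => (g z)⁻¹ i j) y := by
  simp only [Matrix.inv_def, Matrix.smul_apply, Matrix.adjugate_apply, smul_eq_mul,
    Ring.inverse_eq_inv']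
  refine ((contDiffAt_det hg).inv hdet).mul (contDiffAt_det fun a b => ?_)
  simp only [Matrix.updateRow_apply]
  split_ifs
  · exact contDiffAt_const
  · exact hg _ _

theorem contDiffAt_christoffelUpper {y : EuclideanSpace ℝ (Fin n)}
    (hg : ∀ i j, ContDiffAt ℝ 2 (fun z => g z i j) y)
    (hdet : (g y).det ≠ 0) (m i j : Fin n) : ContDiffAt ℝ 1 (christoffelUpper g m i j) y := by
  simp only [funext (christoffelUpper_eq (g := g) m i j)]
  exact ContDiffAt.sum fun a _ => ((contDiffAt_inv_apply hg hdet m a).of_le (by norm_num)).mul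
    (contDiffAt_christoffelLower hg a i j)

/-- The coefficients of the curvature operator of the metric `g` at `y`. -/
noncomputable def curvatureUpper (g : EuclideanSpace ℝ (Fin n) → Matrix (Fin n) (Fin n) ℝ)
    (m i j k : Fin n) (y : EuclideanSpace ℝ (Fin n)) : ℝ :=
  partialDeriv i (christoffelUpper g m j k) y - partialDeriv j (christoffelUpper g m i k) y
    + ∑ a, (christoffelUpper g m i a y * christoffelUpper g a j k y
      - christoffelUpper g m j a y * christoffelUpper g a i k y)

theorem curvatureUpper_swap (m i j k : Fin n) (y : EuclideanSpace ℝ (Fin n)) :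
    curvatureUpper g m j i k y = -curvatureUpper g m i j k y := by
  simp only [curvatureUpper, Finset.sum_sub_distrib]
  ring

theorem sum_mul_partialDeriv_christoffelUpper {y : EuclideanSpace ℝ (Fin n)}
    (hsymm : ∀ y i j, g y i j = g y j i)
    (hg : ∀ i j, ContDiffAt ℝ 2 (fun z => g z i j) y) (hdet : (g y).det ≠ 0) (k i j l : Fin n) :
    ∑ m, g y k m * partialDeriv i (christoffelUpper g m j l) y
      = partialDeriv i (christoffelLower g k j l) y
        - ∑ m, (christoffelLower g k i m y + christoffelLower g m i k y)
          * christoffelUpper g m j l y := by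
  -- The lowering identity is about to be differentiated, so it is needed on a neighbourhood, where
  -- the determinant stays nonzero.
  have hev : (fun z => ∑ m, g z k m * christoffelUpper g m j l z)
      =ᶠ[𝓝 y] christoffelLower g k j l := by
    filter_upwards [(contDiffAt_det hg).continuousAt.eventually_ne hdet] with z hz
    exact sum_mul_christoffelUpper hz.isUnit k j l
  rw [← partialDeriv_congr i hev, partialDeriv_sum_mul i
    (fun m => (hg k m).differentiableAt (by norm_num))
    (fun m => (contDiffAt_christoffelUpper hg hdet m j l).differentiableAt (by norm_num)),
    Finset.sum_add_distrib]
  simp only [add_comm (christoffelLower g k i _ y), christoffelLower_add hsymm]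
  simp only [hsymm _ _ k]
  ring

theorem sum_mul_christoffelUpper_mul {y : EuclideanSpace ℝ (Fin n)} (hdet : (g y).det ≠ 0)
    (k i j l : Fin n) :
    ∑ m, g y k m * ∑ a, christoffelUpper g m i a y * christoffelUpper g a j l y
      = ∑ a, christoffelLower g k i a y * christoffelUpper g a j l y := by
  simp only [← sum_mul_christoffelUpper hdet.isUnit k i, Finset.mul_sum, Finset.sum_mul]
  rw [Finset.sum_comm]
  exact Finset.sum_congr rfl fun a _ => Finset.sum_congr rfl fun m _ => by ring

/-- Lowering the index past the derivative costs a term in `∂g`. Metric compatibility splits it in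
two, and one half cancels the quadratic term of the curvature. -/
theorem sum_mul_curvatureUpper {y : EuclideanSpace ℝ (Fin n)} (hsymm : ∀ y i j, g y i j = g y j i)
    (hg : ∀ i j, ContDiffAt ℝ 2 (fun z => g z i j) y) (hdet : (g y).det ≠ 0) (k i j l : Fin n) :
    ∑ m, g y k m * curvatureUpper g m i j l y
      = partialDeriv i (christoffelLower g k j l) y - partialDeriv j (christoffelLower g k i l) y
        - ∑ m, christoffelLower g m i k y * christoffelUpper g m j l y
        + ∑ m, christoffelLower g m j k y * christoffelUpper g m i l y := by
  simp only [curvatureUpper, mul_add, mul_sub, Finset.sum_sub_distrib, Finset.sum_add_distrib,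
    sum_mul_christoffelUpper_mul hdet, sum_mul_partialDeriv_christoffelUpper hsymm hg hdet,
    add_mul]
  ring

/-- Both sides are the `g`-inner product of the vectors `Γ^•_{ik}` and `Γ^•_{jl}`. -/
theorem sum_christoffelLower_mul_comm {y : EuclideanSpace ℝ (Fin n)}
    (hsymm : ∀ y i j, g y i j = g y j i)
    (hdet : (g y).det ≠ 0) (i j k l : Fin n) :
    ∑ m, christoffelLower g m i k y * christoffelUpper g m j l y
      = ∑ m, christoffelLower g m j l y * christoffelUpper g m i k y := by
  simp only [← sum_mul_christoffelUpper hdet.isUnit, Finset.sum_mul]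
  rw [Finset.sum_comm]
  refine Finset.sum_congr rfl fun a _ => Finset.sum_congr rfl fun m _ => ?_
  rw [hsymm]
  ring

/-- Symmetrizing the lowered curvature in `k, l` leaves `∂_i ∂_j g_{kl} - ∂_j ∂_i g_{kl} = 0`, since
the quadratic terms cancel in pairs. -/
theorem sum_mul_curvatureUpper_swap {y : EuclideanSpace ℝ (Fin n)}
    (hsymm : ∀ y i j, g y i j = g y j i)
    (hg : ∀ i j, ContDiffAt ℝ 2 (fun z => g z i j) y) (hdet : (g y).det ≠ 0) (k i j l : Fin n) :
    ∑ m, g y l m * curvatureUpper g m i j k y = -∑ m, g y k m * curvatureUpper g m i j l y := by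
  have hd (a b c) : DifferentiableAt ℝ (christoffelLower g a b c) y :=
    (contDiffAt_christoffelLower hg a b c).differentiableAt (by norm_num)
  have hadd (i j) : partialDeriv i (christoffelLower g k j l) y
      + partialDeriv i (christoffelLower g l j k) y
      = partialDeriv i (partialDeriv j fun z => g z k l) y := by
    rw [← partialDeriv_add i (hd _ _ _) (hd _ _ _)]
    simp only [christoffelLower_add hsymm]
  have h1 := hadd i j
  have h2 := hadd j i
  rw [partialDeriv_comm j i (hg k l)] at h2
  rw [sum_mul_curvatureUpper hsymm hg hdet, sum_mul_curvatureUpper hsymm hg hdet,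
    sum_christoffelLower_mul_comm hsymm hdet i j l k,
    sum_christoffelLower_mul_comm hsymm hdet j i l k]
  linarith

end Coordinates

end MinimalNormTensor

namespace MinimalNormTensor

/-! ### The curvature tensor of a Riemannian manifold -/

section Manifold

open Filter Topology

variable {n : ℕ} {M : Type*} [TopologicalSpace M] [ChartedSpace (EuclideanSpace ℝ (Fin n)) M]

/-- A coordinate field is the tangent map of the inverse chart applied to a constant section, hence
smooth. -/
theorem contMDiffOn_coordVec [IsManifold (𝓡 n) ∞ M] (p : M) (i : Fin n) :
    ContMDiffOn 𝓘(ℝ, EuclideanSpace ℝ (Fin n)) ((𝓡 n).prod 𝓘(ℝ, EuclideanSpace ℝ (Fin n))) 2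
      (fun y => (⟨(extChartAt (𝓡 n) p).symm y, coordVec p y i⟩ : TangentBundle (𝓡 n) M))
      (extChartAt (𝓡 n) p).target := by
  have hopen : IsOpen (extChartAt (𝓡 n) p).target := isOpen_extChartAt_target p
  have h := (contMDiffOn_extChartAt_symm (I := 𝓡 n) (n := ∞) p).contMDiffOn_tangentMapWithin
    (m := 2) (by norm_cast) hopen.uniqueMDiffOn
  have hs : ContMDiff 𝓘(ℝ, EuclideanSpace ℝ (Fin n))
      (𝓘(ℝ, EuclideanSpace ℝ (Fin n)).prod 𝓘(ℝ, EuclideanSpace ℝ (Fin n))) 2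
      (fun y : EuclideanSpace ℝ (Fin n) => (⟨y, EuclideanSpace.single i (1 : ℝ)⟩ :
        TangentBundle 𝓘(ℝ, EuclideanSpace ℝ (Fin n)) (EuclideanSpace ℝ (Fin n)))) :=
    contMDiff_vectorSpace_iff_contDiff.2 contDiff_const
  refine (h.comp hs.contMDiffOn (fun y hy => hy)).congr fun y hy => ?_
  simp only [Function.comp, tangentMapWithin, coordVec, mfderivWithin_of_isOpen hopen hy]

variable [RiemannianBundle (fun x : M ↦ TangentSpace (𝓡 n) x)]

theorem contDiffAt_metricCoeff [IsManifold (𝓡 n) ∞ M]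
    [IsContMDiffRiemannianBundle (𝓡 n) ∞ (EuclideanSpace ℝ (Fin n))
      (fun x : M ↦ TangentSpace (𝓡 n) x)] (p : M) (i j : Fin n) :
    ContDiffAt ℝ 2 (fun y => metricCoeff p y i j) (extChartAt (𝓡 n) p p) := by
  have hmem : (extChartAt (𝓡 n) p).target ∈ 𝓝 (extChartAt (𝓡 n) p p) :=
    extChartAt_target_mem_nhds p
  have : IsContMDiffRiemannianBundle (𝓡 n) 2 (EuclideanSpace ℝ (Fin n))
      (fun x : M ↦ TangentSpace (𝓡 n) x) := .of_le (n := ∞) (by norm_cast)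
  rw [← contMDiffAt_iff_contDiffAt]
  exact ((contMDiffOn_coordVec p i).contMDiffAt hmem).inner_bundle
    ((contMDiffOn_coordVec p j).contMDiffAt hmem)

theorem metricCoeff_symm (p : M) (y : EuclideanSpace ℝ (Fin n)) (i j : Fin n) :
    metricCoeff p y i j = metricCoeff p y j i := by
  simp only [metricCoeff, Matrix.of_apply]
  exact real_inner_comm _ _

/-- The metric matrix is the Gram matrix of the image of the standard basis under an invertible
differential. -/
theorem det_metricCoeff_ne_zero [IsManifold (𝓡 n) ∞ M] (p : M) :
    (metricCoeff p (extChartAt (𝓡 n) p p)).det ≠ 0 := by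
  set y₀ := extChartAt (𝓡 n) p p
  have hli : LinearIndependent ℝ (coordVec p y₀) := by
    have hinv :
      (mfderiv 𝓘(ℝ, EuclideanSpace ℝ (Fin n)) (𝓡 n) (extChartAt (𝓡 n) p).symm y₀).IsInvertible := by
      have h := isInvertible_mfderivWithin_extChartAt_symm (I := 𝓡 n) (mem_extChartAt_target p)
      rwa [ModelWithCorners.Boundaryless.range_eq_univ, mfderivWithin_univ] at h
    have := (EuclideanSpace.basisFun (Fin n) ℝ).toBasis.linearIndependent.map'
      (mfderiv 𝓘(ℝ, EuclideanSpace ℝ (Fin n)) (𝓡 n) (extChartAt (𝓡 n) p).symm y₀).toLinearMap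
      (LinearMap.ker_eq_bot.2 hinv.injective)
    have hcomp : coordVec p y₀ = (mfderiv 𝓘(ℝ, EuclideanSpace ℝ (Fin n)) (𝓡 n)
        (extChartAt (𝓡 n) p).symm y₀).toLinearMap ∘ (EuclideanSpace.basisFun
          (Fin n) ℝ).toBasis := by
      funext i
      simp only [Function.comp, OrthonormalBasis.coe_toBasis, EuclideanSpace.basisFun_apply]
      rfl
    rw [hcomp]
    exact this
  exact (Matrix.posDef_gram_of_linearIndependent (𝕜 := ℝ) hli).det_pos.ne'

theorem riemann_swap_left (p : M) (X Y Z W : TangentSpace (𝓡 n) p) :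
    riemann p Y X Z W = -riemann p X Y Z W := by
  have h (m i j k : Fin n) : curvatureCoeff p m j i k = -curvatureCoeff p m i j k :=
    -- The manifold's `christoffel` and `curvatureCoeff` unfold to the coordinate versions for
    -- `metricCoeff p`.
    curvatureUpper_swap (g := metricCoeff p) m i j k _
  simp only [riemann]
  rw [Finset.sum_comm]
  simp only [← Finset.sum_neg_distrib]
  refine Finset.sum_congr rfl fun i _ => Finset.sum_congr rfl fun j _ =>
    Finset.sum_congr rfl fun k _ => Finset.sum_congr rfl fun l _ => ?_
  simp only [fun m => h m i j l, mul_neg, Finset.sum_neg_distrib]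
  ring

theorem riemann_swap_right [IsManifold (𝓡 n) ∞ M]
    [IsContMDiffRiemannianBundle (𝓡 n) ∞ (EuclideanSpace ℝ (Fin n))
      (fun x : M ↦ TangentSpace (𝓡 n) x)] (p : M) (X Y Z W : TangentSpace (𝓡 n) p) :
    riemann p X Y W Z = -riemann p X Y Z W := by
  have h (i j k l : Fin n) : ∑ m, metricCoeff p (extChartAt (𝓡 n) p p) l m
      * curvatureCoeff p m i j k
      = -∑ m, metricCoeff p (extChartAt (𝓡 n) p p) k m * curvatureCoeff p m i j l :=
    sum_mul_curvatureUpper_swap (metricCoeff_symm p) (contDiffAt_metricCoeff p)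
      (det_metricCoeff_ne_zero p) k i j l
  simp only [riemann]
  simp only [← Finset.sum_neg_distrib]
  refine Finset.sum_congr rfl fun i _ => Finset.sum_congr rfl fun j _ => ?_
  rw [Finset.sum_comm]
  refine Finset.sum_congr rfl fun k _ => Finset.sum_congr rfl fun l _ => ?_
  rw [h i j k l]
  ring

end Manifold

end MinimalNormTensor

theorem corollary1p5 {n : ℕ} (hn : 3 ≤ n) {M : Type*} [TopologicalSpace M]
    [ChartedSpace (EuclideanSpace ℝ (Fin n)) M] [IsManifold (𝓡 n) ∞ M]
    [RiemannianBundle (fun x : M ↦ TangentSpace (𝓡 n) x)]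
    [IsContMDiffRiemannianBundle (𝓡 n) ∞ (EuclideanSpace ℝ (Fin n))
      (fun x : M ↦ TangentSpace (𝓡 n) x)]
    (p : M) (e : OrthonormalBasis (Fin n) ℝ (TangentSpace (𝓡 n) p))
    (F : MinimalNormTensor.Tensor4 n) :
    MinimalNormTensor.IsMinimalNormTensor (MinimalNormTensor.riemannComponents p e) F ↔
      F = MinimalNormTensor.weyl (MinimalNormTensor.riemannComponents p e) := by
  have h12 (i j k l : Fin n) : MinimalNormTensor.riemannComponents p e j i k l =
      -MinimalNormTensor.riemannComponents p e i j k l :=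
    MinimalNormTensor.riemann_swap_left p _ _ _ _
  have h34 (i j k l : Fin n) : MinimalNormTensor.riemannComponents p e i j l k =
      -MinimalNormTensor.riemannComponents p e i j k l :=
    MinimalNormTensor.riemann_swap_right p _ _ _ _
  exact (MinimalNormTensor.isTraceFree_weyl hn h12 h34).isMinimalNormTensor_iff
    (MinimalNormTensor.ansatz_weylCoeffs _) F
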